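/- Let $T\ge 2$ and consider a $T$-node discrete memoryless, time-invariant multiple-relay channel with finite non-empty input alphabets $\mathcal X_1,\dots,\mathcal X_{T-1}$, finite output alphabets $\mathcal Y_2,\dots,\mathcal Y_T$ and transition law $p^*(y_2,\dots,y_T\mid x_1,\dots,x_{T-1})$; node $1$ is the source, nodes $2,\dots,T-1$ are relays and node $T$ is the destination. A code for a message $W$ uniform on a set of size $M$, with $n$ channel uses, consists of a source encoder $\mathcal W\to\mathcal X_1^n$, relay encoders $f_{ti}:\mathcal Y_t^{i-1}\to\mathcal X_t$ and a decoder $\mathcal Y_T^n\to\mathcal W$; its rate is $\frac1n\log_2 M$ and $P_e=\Pr\{\hat W\ne W\}$. A one-hop myopic decode-forward (point-to-point) code sends $B$ messages $w_1,\dots,w_B$ from a finite set over $B+T-2$ blocks of $n$ channel uses along an order $\pi(1)=1,\pi(2),\dots,\pi(T-1),\pi(T)=T$, where $\pi$ permutes the relays. Each node stores only one message at a time. In block $b$, node $\pi(t)$, $t\le T-1$, transmits a codeword that depends only on (its estimate of) $w_{b-t+1}$, decoded at the end of the preceding block if $t\ge2$. At the end of block $b$, node $\pi(t)$, $t\ge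 2$, decodes $w_{b-t+2}$ from the signal it received in block $b$ and the one message in its memory, its estimate of $w_{b-t+1}$. Messages with index outside $\{1,\dots,B\}$ are replaced by a fixed dummy. Such a code is in particular a code, with message $(w_1,\dots,w_B)$ and $(B+T-2)n$ channel uses, in the above sense. A rate $R$ is achievable by one-hop myopic decode-forward if for all $\epsilon,\delta>0$ there is a one-hop myopic decode-forward code of rate at least $R-\delta$ with $P_e<\epsilon$ for which, moreover, each relay decodes all messages correctly with probability greater than $1-\epsilon$. Theorem. The maximum $$R_{\text{1-hop}}=\max_{\pi}\ \max_{p(x_1)p(x_2)\cdots p(x_{T-1})}\ \min_{t\in\{2,\dots,T\}} I\big(X_{\pi(t-1)};Y_{\pi(t)}\,\big|\,X_{\pi(t)}\big)$$ exists, where $X_{\pi(T)}=0$, $\pi$ ranges over the permutations of the relays (with $\pi(1)=1$, $\pi(T)=T$), and the mutual informations, in bits, are computed under $p(x_1)\cdots p(x_{T-1})\,p^*(y_2,\dots,y_T\mid x_1,\dots,x_{T-1})$. Every rate $R\le R_{\text{1-hop}}$ is achievable by one-hop myopic decode-forward. -/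

import Mathlib

/-!
Conventions.  The channel has `T = r + 2` nodes: the source (node `1`), `r` relays
(nodes `2, …, T - 1`) and the destination (node `T`).

* Nodes `1, …, T - 1` transmit.  `X s`, `s : Fin (r + 1)`, is the input alphabet of the `s`-th
  transmitter: `X 0` belongs to the source and `X k.succ` to the relay `k : Fin r`.
* Nodes `2, …, T` receive.  `Y s`, `s : Fin (r + 1)`, is the output alphabet of the `s`-th
  receiver: `Y k.castSucc` belongs to the relay `k : Fin r` and `Y (Fin.last r)` to the
  destination.

All logarithms are to base `2`.
-/

noncomputable section

namespace MultipleRelay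

universe u v w

/-- A discrete multiple-relay channel: a conditional distribution `law x y = p*(y | x)` of the
outputs of all receivers given the inputs of all transmitters. -/
structure Channel {r : ℕ} (X : Fin (r + 1) → Type u) (Y : Fin (r + 1) → Type v)
    [∀ s, Fintype (Y s)] where
  law : (∀ s, X s) → (∀ s, Y s) → ℝ
  law_mem : ∀ x, law x ∈ stdSimplex ℝ (∀ s, Y s)

/-! ### Information measures of finite random variables -/

section Information

variable {Ω : Type*} [Fintype Ω] {α β γ : Type*} [Fintype α] [Fintype β] [Fintype γ]

open Classical in
/-- The distribution of the random variable `A` when `Ω` carries the mass function `μ`. -/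
def distribution (μ : Ω → ℝ) (A : Ω → α) (a : α) : ℝ :=
  ∑ ω, if A ω = a then μ ω else 0

/-- Shannon entropy `H(A) = - ∑ P(a) log₂ P(a)`, in bits. -/
def entropy (μ : Ω → ℝ) (A : Ω → α) : ℝ :=
  -∑ a, distribution μ A a * Real.logb 2 (distribution μ A a)

/-- Conditional entropy `H(A | C) = H(A, C) - H(C)`. -/
def condEntropy (μ : Ω → ℝ) (A : Ω → α) (C : Ω → γ) : ℝ :=
  entropy μ (fun ω => (A ω, C ω)) - entropy μ C

/-- Conditional mutual information `I(A ; B | C) = H(A | C) - H(A | B, C)`. -/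
def condMutualInfo (μ : Ω → ℝ) (A : Ω → α) (B : Ω → β) (C : Ω → γ) : ℝ :=
  condEntropy μ A C - condEntropy μ A (fun ω => (B ω, C ω))

end Information

section Rates

variable {r : ℕ} {X : Fin (r + 1) → Type u} {Y : Fin (r + 1) → Type v}
  [∀ s, Fintype (X s)] [∀ s, Fintype (Y s)]

/-- The joint distribution `p(x₁) ⋯ p(x_{T-1}) p*(y₂, …, y_T | x₁, …, x_{T-1})`. -/
def jointLaw (W : Channel X Y) (p : ∀ s, stdSimplex ℝ (X s))
    (ω : (∀ s, X s) × (∀ s, Y s)) : ℝ :=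
  (∏ s, (p s).1 (ω.1 s)) * W.law ω.1 ω.2

/-- The transmitter in position `h` when data flow through the source and then the relays
`π 0, π 1, …, π (r - 1)`.  Position `0` is the source. -/
def sender {r : ℕ} (π : Equiv.Perm (Fin r)) : Fin (r + 1) → Fin (r + 1) :=
  Fin.cons 0 (fun a => (π a).succ)

/-- The reception rate of the node in position `h + 1`: for the relay `π a` it is
`I(X_pred ; Y_own | X_own)`, and for the destination, which transmits nothing, the conditioning
variable is constant. -/
def receptionRate (W : Channel X Y) (π : Equiv.Perm (Fin r)) (p : ∀ s, stdSimplex ℝ (X s)) :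
    Fin (r + 1) → ℝ :=
  Fin.snoc (α := fun _ => ℝ)
    (fun a : Fin r => condMutualInfo (jointLaw W p)
      (fun ω => ω.1 (sender π a.castSucc)) (fun ω => ω.2 (π a).castSucc)
      (fun ω => ω.1 (π a).succ))
    (condMutualInfo (jointLaw W p)
      (fun ω => ω.1 (sender π (Fin.last r))) (fun ω => ω.2 (Fin.last r)) (fun _ => ()))

/-- The smallest reception rate along the order `π`. -/
def minReceptionRate (W : Channel X Y) (π : Equiv.Perm (Fin r))
    (p : ∀ s, stdSimplex ℝ (X s)) : ℝ :=
  Finset.univ.inf' Finset.univ_nonempty (receptionRate W π p)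

end Rates

/-! ### Codes -/

/-- A code of block length `n` with message set `𝓦`. -/
structure Code {r : ℕ} (X : Fin (r + 1) → Type u) (Y : Fin (r + 1) → Type v)
    (𝓦 : Type w) (n : ℕ) where
  /-- The encoding function of the source. -/
  encSource : 𝓦 → Fin n → X 0
  /-- The `i`-th encoding function of each relay acts on the symbols it received before. -/
  encRelay : (k : Fin r) → (i : Fin n) → (Fin i → Y k.castSucc) → X k.succ
  /-- The decoding function of the destination. -/
  decode : (Fin n → Y (Fin.last r)) → 𝓦

namespace Code

variable {r : ℕ} {X : Fin (r + 1) → Type u} {Y : Fin (r + 1) → Type v} {𝓦 : Type w} {n : ℕ}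

/-- The channel input at time `i` for the message `m`, when the channel outputs are `y`. -/
def input (C : Code X Y 𝓦 n) (m : 𝓦) (y : Fin n → ∀ s, Y s) (i : Fin n) : ∀ s, X s :=
  Fin.cons (C.encSource m i)
    (fun k => C.encRelay k i (fun j => y (Fin.castLE i.isLt.le j) k.castSucc))

variable [∀ s, Fintype (Y s)] [Fintype 𝓦]

/-- The probability of the outputs `y` given the message `m`, for `n` uses of the memoryless
time-invariant channel. -/
def outputProb (C : Code X Y 𝓦 n) (W : Channel X Y) (m : 𝓦) (y : Fin n → ∀ s, Y s) : ℝ :=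
  ∏ i, W.law (C.input m y i) (y i)

open Classical in
/-- The probability of an event about the message, which is uniformly distributed, and the
channel outputs. -/
def prob (C : Code X Y 𝓦 n) (W : Channel X Y) (E : 𝓦 → (Fin n → ∀ s, Y s) → Prop) : ℝ :=
  (Fintype.card 𝓦 : ℝ)⁻¹ * ∑ m, ∑ y, if E m y then C.outputProb W m y else 0

/-- The average error probability at the destination. -/
def errorProb (C : Code X Y 𝓦 n) (W : Channel X Y) : ℝ :=
  C.prob W (fun m y => C.decode (fun i => y i (Fin.last r)) ≠ m)

/-- The rate `(1 / n) log₂ M`, in bits per channel use. -/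
def rate (_C : Code X Y 𝓦 n) : ℝ :=
  Real.logb 2 (Fintype.card 𝓦) / n

end Code

/-! ### One-hop myopic decode-forward -/

/-- A one-hop myopic decode-forward (point-to-point coding) scheme.  The source sends `B`
messages from `Fin M` one after the other; transmission takes place in `B + r` blocks of `n`
channel uses each.  A node is described by a codebook of its own (if it transmits) and a decoding
rule of its own (if it receives). -/
structure OneHopScheme {r : ℕ} (X : Fin (r + 1) → Type u) (Y : Fin (r + 1) → Type v)
    (M B n : ℕ) where
  /-- The order `π 0, π 1, …, π (r - 1)` in which data flow through the relays. -/
  order : Equiv.Perm (Fin r)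
  /-- The message encoded in blocks in which there is no message to send. -/
  dummy : Fin M
  /-- The codeword of one message at each transmitter. -/
  codeword : (s : Fin (r + 1)) → Fin M → Fin n → X s
  /-- The decoding rule of each receiver: it sees one block of its received signal and the one
  message in its memory, and returns one message. -/
  decodeBlock : (s : Fin (r + 1)) → (Fin n → Y s) → Fin M → Fin M

namespace OneHopScheme

variable {r : ℕ} {X : Fin (r + 1) → Type u} {Y : Fin (r + 1) → Type v} {M B n : ℕ}

/-- The position of the relay `k` in the flow of data: the source is in position `0`, the relay
`order a` in position `a + 1`, and the destination in position `r + 1`. -/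
def position (S : OneHopScheme X Y M B n) (k : Fin r) : ℕ := (S.order.symm k : ℕ) + 1

/-- The message that the source encodes in block `c`, where blocks and messages are numbered
from `0`. -/
def sourceMessage (S : OneHopScheme X Y M B n) (m : Fin B → Fin M) (c : ℕ) : Fin M :=
  if h : c < B then m ⟨c, h⟩ else S.dummy

/-- The one message in the memory of receiver `s`, which is in position `q`, during block `c`.
It was decoded at the end of the previous block, from the signal received in that block and
from the message that was then in memory, which is discarded.  It is an estimate of message
number `c - q`, and it is a dummy when no message has that number.  It depends on the first
`c * n` received symbols only. -/
def memory (S : OneHopScheme X Y M B n) (s : Fin (r + 1)) (q : ℕ) {i : ℕ} (y : Fin i → Y s) :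
    (c : ℕ) → c * n ≤ i → Fin M
  | 0, _ => S.dummy
  | c + 1, h =>
    if q ≤ c + 1 ∧ c + 1 < q + B then
      S.decodeBlock s
        (fun l => y ⟨c * n + l, lt_of_lt_of_le (by have := l.isLt; rw [Nat.succ_mul]; omega) h⟩)
        (S.memory s q y c (le_trans (Nat.mul_le_mul_right n (Nat.le_succ c)) h))
    else S.dummy

/-- The estimate of message number `j` at the relay `k`. -/
def relayEstimate (S : OneHopScheme X Y M B n) (k : Fin r)
    (y : Fin ((B + r) * n) → Y k.castSucc) (j : Fin B) : Fin M :=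
  S.memory k.castSucc (S.position k) y (j + S.position k)
    (Nat.mul_le_mul_right n (by
      have h₁ := (S.order.symm k).isLt
      have h₂ := j.isLt
      unfold position
      omega))

/-- The estimate of message number `j` at the destination. -/
def destEstimate (S : OneHopScheme X Y M B n)
    (y : Fin ((B + r) * n) → Y (Fin.last r)) (j : Fin B) : Fin M :=
  S.memory (Fin.last r) (r + 1) y (j + (r + 1))
    (Nat.mul_le_mul_right n (by have h₂ := j.isLt; omega))

/-- The channel index within its block of time `i`. -/
def offset {N n : ℕ} (i : Fin (N * n)) : Fin n :=
  ⟨i % n, Nat.mod_lt _ (Nat.pos_of_ne_zero (by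
    intro h
    have := i.isLt
    simp [h] at this))⟩

/-- The code for the `B` messages, over `(B + r) * n` channel uses, that the scheme defines: in
each block every relay sends the codeword of the message in its memory. -/
def toCode (S : OneHopScheme X Y M B n) : Code X Y (Fin B → Fin M) ((B + r) * n) where
  encSource m i := S.codeword 0 (S.sourceMessage m (i / n)) (offset i)
  encRelay k i y :=
    S.codeword k.succ
      (S.memory k.castSucc (S.position k) y (i / n) (Nat.div_mul_le_self i n)) (offset i)
  decode := S.destEstimate

end OneHopScheme

/-- The rate `R` is achievable by one-hop myopic decode-forward on the memoryless multiple-relay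
channel `W`: there are schemes of rate as close to `R` (or as far above it) and of average error
probability as small as desired, in which every relay decodes all the messages. -/
def OneHopAchievable {r : ℕ} {X : Fin (r + 1) → Type u} {Y : Fin (r + 1) → Type v}
    [∀ s, Fintype (Y s)] (W : Channel X Y) (R : ℝ) : Prop :=
  ∀ ε > 0, ∀ δ > 0, ∃ (M B n : ℕ) (_ : 0 < B) (_ : 0 < n) (S : OneHopScheme X Y M B n),
    R - δ ≤ S.toCode.rate ∧
    S.toCode.errorProb W < ε ∧
    ∀ k : Fin r,
      S.toCode.prob W (fun m y => S.relayEstimate k (fun i => y i k.castSucc) ≠ m) < ε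

end MultipleRelay

end

noncomputable section

namespace MultipleRelay

universe u v w

/-! ### Sums of products over finite types -/

section FiniteSums

/-! The proof is random coding. Every letter of every codeword is drawn independently from `p`, and
the same codebooks serve in all blocks. A receiver looks for a message whose codeword has a large
product of ratios P(a | b, c) / P(a | c), where a is the predecessor's letter, b the received letter
and c the receiver's own input letter. It knows its own input because it sends the codeword of the
message in its memory. The true codeword passes the threshold by Chebyshev's inequality. Each wrong
one passes with probability at most the inverse threshold, by Markov's inequality and the
independence of inputs. The other transmitters are averaged into the channel
(`sum_codebookWeight_mul_error_le`, `eventually_exists_decoder`). Error propagation is handled by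
comparison with an ideal process in which all transmitters send the right messages. The two output
laws agree wherever no receiver with correct memory errs at the end of a block. Both have total mass
one, so they give the same probability to the complement, which is bounded by a union over blocks
and receivers under the ideal law (`sum_outputProb_someBlockError_le`). The average of this bound
over codebooks is small, so some codebook is good for all receivers at once. The factor `B / (B +
r)` lost to pipelining tends to one. The maximum exists because the rates are continuous on a
product of simplices and there are finitely many orders. -/

theorem sum_prod_comp_injective {ι κ : Type*} [Fintype ι] [DecidableEq ι] [Fintype κ]
    [DecidableEq κ] {A : ι → Type*} [∀ i, Fintype (A i)] (w : ∀ i, A i → ℝ)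
    (hw : ∀ i, ∑ a, w i a = 1) (e : κ → ι) (he : Function.Injective e)
    (F : (∀ k, A (e k)) → ℝ) :
    ∑ a : ∀ i, A i, (∏ i, w i (a i)) * F (fun k => a (e k)) =
      ∑ z : ∀ k, A (e k), (∏ k, w (e k) (z k)) * F z := by
  classical
  -- Marginalisation: the coordinates outside the range of `e` do not enter `F`, and their weights
  -- sum to one.
  have h₁ : ∑ a : ∀ i, A i, (∏ i, w i (a i)) * F (fun k => a (e k)) =
      ∑ ab : (∀ i : {i // i ∈ Set.range e}, A i) × (∀ i : {i // ¬ i ∈ Set.range e}, A i),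
        ((∏ i : {i // i ∈ Set.range e}, w i (ab.1 i)) * F (fun k => ab.1 ⟨e k, k, rfl⟩)) *
          ∏ i : {i // ¬ i ∈ Set.range e}, w i (ab.2 i) := by
    refine Fintype.sum_equiv (Equiv.piEquivPiSubtypeProd (· ∈ Set.range e) A) _ _ fun a => ?_
    rw [← Fintype.prod_subtype_mul_prod_subtype (· ∈ Set.range e) fun i => w i (a i)]
    rw [mul_right_comm]
    congr!
  have h₂ : ∑ b : ∀ i : {i // ¬ i ∈ Set.range e}, A i,
      ∏ i : {i // ¬ i ∈ Set.range e}, w i (b i) = 1 := by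
    rw [← Fintype.prod_sum fun (i : {i // ¬ i ∈ Set.range e}) (a : A i) => w i a]
    exact Finset.prod_eq_one fun i _ => hw i
  rw [h₁, Fintype.sum_prod_type]
  simp only [← Finset.mul_sum, h₂, mul_one]
  let σ := Equiv.ofInjective e he
  refine Fintype.sum_equiv
    (Equiv.piCongrLeft (fun i : {i // i ∈ Set.range e} => A i) σ).symm _ _ fun a => ?_
  congr 1
  exact (Fintype.prod_equiv σ _ _ fun k => rfl).symm

/-- The last symbol occurs only in the last factor, so it can be summed out first. This is what
makes the outputs of a code with causal relays a probability distribution. -/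
theorem sum_prod_causal {A : Type*} [Fintype A] : ∀ (n : ℕ)
    (g : (i : Fin n) → (Fin i → A) → A → ℝ) (_ : ∀ i h, ∑ a, g i h a = 1),
    ∑ y : Fin n → A, ∏ i, g i (fun j => y (Fin.castLE i.isLt.le j)) (y i) = 1
  | 0, _, _ => by simp
  | n + 1, g, hg => by
    rw [← Fintype.sum_equiv (Fin.snocEquiv fun _ => A)
      (fun ab => (∏ i : Fin n, g i.castSucc (fun j => ab.2 (Fin.castLE i.isLt.le j)) (ab.2 i)) *
        g (Fin.last n) ab.2 ab.1) _ ?_]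
    · rw [Fintype.sum_prod_type_right]
      simp only [← Finset.mul_sum, hg, mul_one]
      exact sum_prod_causal n (fun i => g i.castSucc) fun i => hg i.castSucc
    · rintro ⟨a, y⟩
      rw [Fin.prod_univ_castSucc]
      simp only [Fin.snocEquiv, Equiv.coe_fn_mk, Fin.snoc_castSucc, Fin.snoc_last]
      congr 1
      · refine Finset.prod_congr rfl fun i _ => ?_
        congr 1
        funext j
        exact (Fin.snoc_castSucc (α := fun _ => A) a y (Fin.castLE i.isLt.le j)).symm
      · congr 1
        funext j
        exact (Fin.snoc_castSucc (α := fun _ => A) a y j).symm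

variable {Ω : Type*} [Fintype Ω]

theorem sum_prod_eq_one {μ : Ω → ℝ} (hμ : ∑ ω, μ ω = 1) (n : ℕ) :
    ∑ ω : Fin n → Ω, ∏ i, μ (ω i) = 1 := by
  rw [← Fintype.prod_sum fun (_ : Fin n) => μ]
  simp [hμ]

theorem sum_prod_mul_sum_eq_zero {μ g : Ω → ℝ} (hμ : ∑ ω, μ ω = 1)
    (hg : ∑ ω, μ ω * g ω = 0) (n : ℕ) :
    ∑ ω : Fin n → Ω, (∏ i, μ (ω i)) * ∑ i, g (ω i) = 0 := by
  simp only [Finset.mul_sum]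
  rw [Finset.sum_comm]
  refine Finset.sum_eq_zero fun i _ => ?_
  have h := sum_prod_comp_injective (fun _ : Fin n => μ) (fun _ => hμ) (fun _ : Unit => i)
    (Function.injective_of_subsingleton _) fun z => g (z ())
  rw [h, ← Fintype.sum_equiv (Equiv.funUnique Unit Ω).symm (fun ω => μ ω * g ω) _ (by simp)]
  exact hg

theorem sum_prod_mul_sum_sq {μ g : Ω → ℝ} (hμ : ∑ ω, μ ω = 1)
    (hg : ∑ ω, μ ω * g ω = 0) : ∀ n : ℕ,
    ∑ ω : Fin n → Ω, (∏ i, μ (ω i)) * (∑ i, g (ω i)) ^ 2 = n * ∑ ω, μ ω * g ω ^ 2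
  | 0 => by simp
  | n + 1 => by
    have ih := sum_prod_mul_sum_sq hμ hg n
    have h₀ := sum_prod_mul_sum_eq_zero hμ hg n
    have h₁ := sum_prod_eq_one hμ n
    -- Expand the square after splitting off the first variable; the cross term vanishes because the
    -- remaining sum is centred.
    rw [← Fintype.sum_equiv (Fin.consEquiv fun _ => Ω)
      (fun ab => μ ab.1 * g ab.1 ^ 2 * (∏ i : Fin n, μ (ab.2 i)) +
        2 * (μ ab.1 * g ab.1) * ((∏ i : Fin n, μ (ab.2 i)) * ∑ i, g (ab.2 i)) +
        μ ab.1 * ((∏ i : Fin n, μ (ab.2 i)) * (∑ i, g (ab.2 i)) ^ 2)) _ ?_]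
    · rw [Fintype.sum_prod_type]
      simp only [Finset.sum_add_distrib, ← Finset.mul_sum, h₀, h₁, ih, ← Finset.sum_mul, hμ]
      push_cast
      ring
    · rintro ⟨a, y⟩
      simp only [Fin.consEquiv, Equiv.coe_fn_mk, Fin.prod_univ_succ, Fin.sum_univ_succ,
        Fin.cons_zero, Fin.cons_succ]
      ring

open Classical in
/-- Chebyshev's inequality for the sum of independent identically distributed variables. -/
theorem sum_prod_ite_sum_lt_le {μ : Ω → ℝ} (hμ₀ : ∀ ω, 0 ≤ μ ω) (hμ : ∑ ω, μ ω = 1)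
    (f : Ω → ℝ) {η : ℝ} (hη : 0 < η) {n : ℕ} (hn : 0 < n) :
    ∑ ω : Fin n → Ω,
        (if ∑ i, f (ω i) < n * (∑ a, μ a * f a - η) then ∏ i, μ (ω i) else 0) ≤
      (∑ a, μ a * (f a - ∑ b, μ b * f b) ^ 2) / η ^ 2 / n := by
  set E := ∑ b, μ b * f b with hE
  have hg : ∑ ω, μ ω * (f ω - E) = 0 := by
    simp [mul_sub, Finset.sum_sub_distrib, ← Finset.sum_mul, hμ, hE]
  have h := sum_prod_mul_sum_sq hμ hg n
  have hn' : (0 : ℝ) < n := by exact_mod_cast hn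
  have hle : ∑ ω : Fin n → Ω, (if ∑ i, f (ω i) < n * (E - η) then ∏ i, μ (ω i) else 0) ≤
      ∑ ω : Fin n → Ω, ((∏ i, μ (ω i)) * (∑ i, (f (ω i) - E)) ^ 2) / (n * η) ^ 2 := by
    refine Finset.sum_le_sum fun ω _ => ?_
    have hp : 0 ≤ ∏ i, μ (ω i) := Finset.prod_nonneg fun i _ => hμ₀ _
    split_ifs with hω
    · rw [le_div_iff₀ (by positivity)]
      refine mul_le_mul_of_nonneg_left ?_ hp
      have hs : ∑ i, (f (ω i) - E) = ∑ i, f (ω i) - n * E := by simp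
      rw [hs]
      have : n * η ≤ -(∑ i, f (ω i) - n * E) := by linarith
      rw [← neg_sq (∑ i, f (ω i) - n * E)]
      exact pow_le_pow_left₀ (by positivity) this 2
    · positivity
  refine hle.trans (le_of_eq ?_)
  rw [← Finset.sum_div, h]
  field_simp

end FiniteSums

/-! ### Information density -/

section Density

variable {Ω : Type*} [Fintype Ω] {α β γ : Type*} {μ : Ω → ℝ}

theorem distribution_nonneg (hμ₀ : ∀ ω, 0 ≤ μ ω) (A : Ω → α) (a : α) :
    0 ≤ distribution μ A a := by
  classical
  exact Finset.sum_nonneg fun ω _ => by split_ifs <;> simp [hμ₀]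

theorem distribution_pos (hμ₀ : ∀ ω, 0 ≤ μ ω) (A : Ω → α) {ω : Ω} (hω : μ ω ≠ 0) :
    0 < distribution μ A (A ω) := by
  classical
  refine lt_of_lt_of_le (lt_of_le_of_ne (hμ₀ ω) hω.symm) ?_
  have h := Finset.single_le_sum (f := fun ω' => if A ω' = A ω then μ ω' else 0)
    (fun ω' _ => by split_ifs <;> simp [hμ₀]) (Finset.mem_univ ω)
  simpa [distribution] using h

theorem sum_distribution_mul [Fintype α] (μ : Ω → ℝ) (A : Ω → α) (φ : α → ℝ) :
    ∑ a, distribution μ A a * φ a = ∑ ω, μ ω * φ (A ω) := by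
  classical
  simp only [distribution, Finset.sum_mul, ite_mul, zero_mul]
  rw [Finset.sum_comm]
  simp

theorem entropy_eq_sum [Fintype α] (μ : Ω → ℝ) (A : Ω → α) :
    entropy μ A = -∑ ω, μ ω * Real.logb 2 (distribution μ A (A ω)) := by
  rw [entropy, sum_distribution_mul μ A fun a => Real.logb 2 (distribution μ A a)]

/-- The ratio `P(a | b, c) / P(a | c)`, whose logarithm is the information density. -/
def density (μ : Ω → ℝ) (A : Ω → α) (B : Ω → β) (C : Ω → γ) (a : α) (b : β)
    (c : γ) : ℝ :=
  distribution μ (fun ω => (A ω, (B ω, C ω))) (a, (b, c)) * distribution μ C c /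
    (distribution μ (fun ω => (A ω, C ω)) (a, c) * distribution μ (fun ω => (B ω, C ω)) (b, c))

theorem density_nonneg (hμ₀ : ∀ ω, 0 ≤ μ ω) (A : Ω → α) (B : Ω → β) (C : Ω → γ) (a : α) (b : β)
    (c : γ) : 0 ≤ density μ A B C a b c :=
  div_nonneg (mul_nonneg (distribution_nonneg hμ₀ _ _) (distribution_nonneg hμ₀ _ _))
    (mul_nonneg (distribution_nonneg hμ₀ _ _) (distribution_nonneg hμ₀ _ _))

theorem density_pos (hμ₀ : ∀ ω, 0 ≤ μ ω) (A : Ω → α) (B : Ω → β) (C : Ω → γ) {ω : Ω}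
    (hω : μ ω ≠ 0) : 0 < density μ A B C (A ω) (B ω) (C ω) :=
  div_pos
    (mul_pos (distribution_pos hμ₀ (fun ω => (A ω, (B ω, C ω))) hω) (distribution_pos hμ₀ C hω))
    (mul_pos (distribution_pos hμ₀ (fun ω => (A ω, C ω)) hω)
      (distribution_pos hμ₀ (fun ω => (B ω, C ω)) hω))

variable [Fintype α] [Fintype β] [Fintype γ]

/-- Where `μ ω ≠ 0` the four probabilities in the density are positive, so its logarithm splits into
the four entropy terms; elsewhere the weight is zero. -/
theorem sum_mul_logb_density (hμ₀ : ∀ ω, 0 ≤ μ ω) (A : Ω → α) (B : Ω → β) (C : Ω → γ) :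
    ∑ ω, μ ω * Real.logb 2 (density μ A B C (A ω) (B ω) (C ω)) = condMutualInfo μ A B C := by
  simp only [condMutualInfo, condEntropy, entropy_eq_sum]
  have h : ∀ ω, μ ω * Real.logb 2 (density μ A B C (A ω) (B ω) (C ω)) =
      μ ω * Real.logb 2 (distribution μ (fun ω => (A ω, (B ω, C ω))) (A ω, (B ω, C ω))) +
      μ ω * Real.logb 2 (distribution μ C (C ω)) -
      μ ω * Real.logb 2 (distribution μ (fun ω => (A ω, C ω)) (A ω, C ω)) -
      μ ω * Real.logb 2 (distribution μ (fun ω => (B ω, C ω)) (B ω, C ω)) := by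
    intro ω
    by_cases hω : μ ω = 0
    · simp [hω]
    · have h₁ := (distribution_pos hμ₀ (fun ω => (A ω, (B ω, C ω))) hω).ne'
      have h₂ := (distribution_pos hμ₀ C hω).ne'
      have h₃ := (distribution_pos hμ₀ (fun ω => (A ω, C ω)) hω).ne'
      have h₄ := (distribution_pos hμ₀ (fun ω => (B ω, C ω)) hω).ne'
      rw [density, Real.logb_div (mul_ne_zero h₁ h₂) (mul_ne_zero h₃ h₄), Real.logb_mul h₁ h₂,
        Real.logb_mul h₃ h₄]
      ring
  simp only [h, Finset.sum_add_distrib, Finset.sum_sub_distrib]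
  ring

/-- For `A` independent of `C` the density is the likelihood ratio of P(a, b, c) against P(a) P(b,
c), so its mean for a fresh `a` is at most one. Zero denominators only contribute zero terms on the
left. -/
theorem sum_mul_density_le_one (hμ₀ : ∀ ω, 0 ≤ μ ω) (hμ : ∑ ω, μ ω = 1) {A : Ω → α} (B : Ω → β)
    {C : Ω → γ} (hAC : ∀ a c, distribution μ (fun ω => (A ω, C ω)) (a, c) =
      distribution μ A a * distribution μ C c) :
    ∑ a, ∑ ω, distribution μ A a * (μ ω * density μ A B C a (B ω) (C ω)) ≤ 1 := by
  have h : ∀ a, ∑ ω, distribution μ A a * (μ ω * density μ A B C a (B ω) (C ω)) =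
      ∑ bc : β × γ, distribution μ A a *
        (distribution μ (fun ω => (B ω, C ω)) bc * density μ A B C a bc.1 bc.2) := by
    intro a
    rw [← Finset.mul_sum, ← Finset.mul_sum,
      sum_distribution_mul μ (fun ω => (B ω, C ω)) fun bc => density μ A B C a bc.1 bc.2]
  simp only [h]
  calc _ ≤ ∑ a, ∑ bc : β × γ, distribution μ (fun ω => (A ω, (B ω, C ω))) (a, bc) := by
        refine Finset.sum_le_sum fun a _ => Finset.sum_le_sum fun bc _ => ?_
        rw [density, hAC]
        have h₁ := distribution_nonneg hμ₀ (fun ω => (A ω, (B ω, C ω))) (a, bc)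
        by_cases ha : distribution μ A a = 0
        · simpa [ha] using h₁
        by_cases hc : distribution μ C bc.2 = 0
        · simpa [hc] using h₁
        by_cases hbc : distribution μ (fun ω => (B ω, C ω)) bc = 0
        · simpa [hbc] using h₁
        · refine le_of_eq ?_
          rw [← mul_assoc, mul_div_assoc']
          rw [div_eq_iff (mul_ne_zero (mul_ne_zero ha hc) hbc)]
          ring
    _ = 1 := by
        rw [← Fintype.sum_prod_type
          (f := fun abc => distribution μ (fun ω => (A ω, (B ω, C ω))) abc)]
        have := sum_distribution_mul μ (fun ω => (A ω, (B ω, C ω))) fun _ => 1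
        simpa [hμ] using this

open Classical in
-- Markov's inequality for the product of densities of an independently drawn word; its mean factors
-- over the letters, each factor being at most one.
theorem sum_prod_ite_le_prod_density_le (hμ₀ : ∀ ω, 0 ≤ μ ω) (hμ : ∑ ω, μ ω = 1) {A : Ω → α}
    (B : Ω → β) {C : Ω → γ} (hAC : ∀ a c, distribution μ (fun ω => (A ω, C ω)) (a, c) =
      distribution μ A a * distribution μ C c) {θ : ℝ} (hθ : 0 < θ) (n : ℕ) :
    ∑ a : Fin n → α, ∑ ω : Fin n → Ω, (∏ i, distribution μ A (a i)) *
      (if θ ≤ ∏ i, density μ A B C (a i) (B (ω i)) (C (ω i)) then ∏ i, μ (ω i) else 0) ≤ θ⁻¹ := by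
  calc _ ≤ ∑ a : Fin n → α, ∑ ω : Fin n → Ω, (∏ i, distribution μ A (a i) *
        (μ (ω i) * density μ A B C (a i) (B (ω i)) (C (ω i)))) * θ⁻¹ := by
        refine Finset.sum_le_sum fun a _ => Finset.sum_le_sum fun ω _ => ?_
        rw [Finset.prod_mul_distrib, mul_assoc]
        refine mul_le_mul_of_nonneg_left ?_
          (Finset.prod_nonneg fun i _ => distribution_nonneg hμ₀ _ _)
        rw [Finset.prod_mul_distrib, ← div_eq_mul_inv]
        have h₁ : 0 ≤ ∏ i, μ (ω i) := Finset.prod_nonneg fun i _ => hμ₀ _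
        have h₂ : 0 ≤ ∏ i, density μ A B C (a i) (B (ω i)) (C (ω i)) :=
          Finset.prod_nonneg fun i _ => density_nonneg hμ₀ _ _ _ _ _ _
        split_ifs with h
        · rw [le_div_iff₀ hθ]
          exact mul_le_mul_of_nonneg_left h h₁
        · positivity
    _ = (∑ a, ∑ ω, distribution μ A a * (μ ω * density μ A B C a (B ω) (C ω))) ^ n * θ⁻¹ := by
        simp only [← Finset.sum_mul]
        congr 1
        have h : ∀ a : Fin n → α, ∑ ω : Fin n → Ω, ∏ i, distribution μ A (a i) *
            (μ (ω i) * density μ A B C (a i) (B (ω i)) (C (ω i))) =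
            ∏ i, ∑ ω, distribution μ A (a i) * (μ ω * density μ A B C (a i) (B ω) (C ω)) :=
          fun a => (Fintype.prod_sum fun (i : Fin n) (ω : Ω) => distribution μ A (a i) *
            (μ ω * density μ A B C (a i) (B ω) (C ω))).symm
        simp only [h]
        rw [← Fintype.prod_sum fun (_ : Fin n) (a : α) =>
          ∑ ω, distribution μ A a * (μ ω * density μ A B C a (B ω) (C ω))]
        simp
    _ ≤ 1 * θ⁻¹ := by
        refine mul_le_mul_of_nonneg_right (pow_le_one₀ ?_ (sum_mul_density_le_one hμ₀ hμ B hAC))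
          (by positivity)
        exact Finset.sum_nonneg fun a _ => Finset.sum_nonneg fun ω _ =>
          mul_nonneg (distribution_nonneg hμ₀ _ _)
            (mul_nonneg (hμ₀ _) (density_nonneg hμ₀ _ _ _ _ _ _))
    _ = θ⁻¹ := one_mul _

open Classical in
-- Chebyshev's inequality for the sum of log densities, whose mean per letter is the conditional
-- mutual information.
theorem sum_prod_ite_prod_density_lt_le (hμ₀ : ∀ ω, 0 ≤ μ ω) (hμ : ∑ ω, μ ω = 1) (A : Ω → α)
    (B : Ω → β) (C : Ω → γ) {η : ℝ} (hη : 0 < η) : ∃ K : ℝ, ∀ n : ℕ, 0 < n →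
    ∑ ω : Fin n → Ω, (if ∏ i, density μ A B C (A (ω i)) (B (ω i)) (C (ω i)) <
      (2 : ℝ) ^ (n * (condMutualInfo μ A B C - η)) then ∏ i, μ (ω i) else 0) ≤ K / n := by
  refine ⟨_, fun n hn => le_trans (Finset.sum_le_sum fun ω _ => ?_) (sum_prod_ite_sum_lt_le hμ₀ hμ
    (fun ω => Real.logb 2 (density μ A B C (A ω) (B ω) (C ω))) hη hn)⟩
  rw [sum_mul_logb_density hμ₀]
  have hp : 0 ≤ ∏ i, μ (ω i) := Finset.prod_nonneg fun i _ => hμ₀ _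
  -- Words of probability zero contribute nothing; on the others every density is positive and
  -- logarithms may be taken.
  by_cases h₀ : ∏ i, μ (ω i) = 0
  · simp [h₀]
  have hpos : ∀ i, 0 < density μ A B C (A (ω i)) (B (ω i)) (C (ω i)) := fun i =>
    density_pos hμ₀ A B C (Finset.prod_ne_zero_iff.mp h₀ i (Finset.mem_univ i))
  rw [← Real.logb_prod _ _ fun i _ => (hpos i).ne']
  have hiff := Real.logb_lt_iff_lt_rpow (b := 2) (by norm_num)
    (Finset.prod_pos fun i (_ : i ∈ Finset.univ) => hpos i)
    (y := n * (condMutualInfo μ A B C - η))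
  simp only [hiff, le_refl]

end Density

/-! ### Random codebooks and threshold decoding -/

section RandomCoding

variable {r : ℕ} {X : Fin (r + 1) → Type u} {Y : Fin (r + 1) → Type v}

/-- A codeword for every transmitter and every message. -/
abbrev Codebook (X : Fin (r + 1) → Type u) (M n : ℕ) :=
  (q : Fin (r + 1) × Fin M) → Fin n → X q.1

theorem Channel.law_nonneg [∀ s, Fintype (Y s)] (W : Channel X Y) (x : ∀ s, X s) (y : ∀ s, Y s) :
    0 ≤ W.law x y :=
  (W.law_mem x).1 y

theorem Channel.sum_law [∀ s, Fintype (Y s)] (W : Channel X Y) (x : ∀ s, X s) :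
    ∑ y, W.law x y = 1 :=
  (W.law_mem x).2

variable [∀ s, Fintype (X s)]

/-- The probability of a word with independent letters. -/
def wordWeight (p : ∀ s, stdSimplex ℝ (X s)) (s : Fin (r + 1)) {n : ℕ} (x : Fin n → X s) : ℝ :=
  ∏ i, (p s).1 (x i)

/-- The probability of a codebook with independent letters. -/
def codebookWeight (p : ∀ s, stdSimplex ℝ (X s)) {M n : ℕ} (C : Codebook X M n) : ℝ :=
  ∏ q, wordWeight p q.1 (C q)

theorem wordWeight_nonneg (p : ∀ s, stdSimplex ℝ (X s)) (s : Fin (r + 1)) {n : ℕ}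
    (x : Fin n → X s) : 0 ≤ wordWeight p s x :=
  Finset.prod_nonneg fun _ _ => (p s).2.1 _

theorem sum_wordWeight (p : ∀ s, stdSimplex ℝ (X s)) (s : Fin (r + 1)) (n : ℕ) :
    ∑ x : Fin n → X s, wordWeight p s x = 1 :=
  sum_prod_eq_one (p s).2.2 n

theorem codebookWeight_nonneg (p : ∀ s, stdSimplex ℝ (X s)) {M n : ℕ} (C : Codebook X M n) :
    0 ≤ codebookWeight p C :=
  Finset.prod_nonneg fun _ _ => wordWeight_nonneg p _ _

theorem sum_codebookWeight (p : ∀ s, stdSimplex ℝ (X s)) (M n : ℕ) :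
    ∑ C : Codebook X M n, codebookWeight p C = 1 := by
  rw [show (1 : ℝ) = ∏ q : Fin (r + 1) × Fin M, ∑ x : Fin n → X q.1, wordWeight p q.1 x by
    simp [sum_wordWeight]]
  exact (Fintype.prod_sum _).symm

/-- The codewords in use belong to different transmitters, hence are independent even when some of
the messages coincide. -/
theorem sum_codebookWeight_mul (p : ∀ s, stdSimplex ℝ (X s)) {M n : ℕ} (μ : Fin (r + 1) → Fin M)
    (F : (∀ s, Fin n → X s) → ℝ) :
    ∑ C : Codebook X M n, codebookWeight p C * F (fun s => C (s, μ s)) =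
      ∑ x : ∀ s, Fin n → X s, (∏ s, wordWeight p s (x s)) * F x :=
  sum_prod_comp_injective (A := fun q : Fin (r + 1) × Fin M => Fin n → X q.1)
    (fun q => wordWeight p q.1) (fun q => sum_wordWeight p q.1 n) (fun s => (s, μ s))
    (fun _ _ h => (Prod.mk.inj h).1) F

/-- A codeword that is not being sent is independent of all those that are: `hm'` makes the index
`(s', m')` differ from every `(s, μ s)`. -/
theorem sum_codebookWeight_mul_of_ne (p : ∀ s, stdSimplex ℝ (X s)) {M n : ℕ}
    (μ : Fin (r + 1) → Fin M) {s' : Fin (r + 1)} {m' : Fin M} (hm' : m' ≠ μ s')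
    (F : (Fin n → X s') → (∀ s, Fin n → X s) → ℝ) :
    ∑ C : Codebook X M n, codebookWeight p C * F (C (s', m')) (fun s => C (s, μ s)) =
      ∑ a : Fin n → X s', ∑ x : ∀ s, Fin n → X s,
        wordWeight p s' a * ((∏ s, wordWeight p s (x s)) * F a x) := by
  have he : Function.Injective
      (fun o : Option (Fin (r + 1)) => o.elim (s', m') fun s => (s, μ s)) := by
    rintro (_ | s) (_ | t) h
    · rfl
    · obtain ⟨rfl, h₂⟩ := Prod.mk.inj h
      exact absurd h₂ hm'
    · obtain ⟨rfl, h₂⟩ := Prod.mk.inj h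
      exact absurd h₂.symm hm'
    · exact congrArg some (Prod.mk.inj h).1
  have h := sum_prod_comp_injective (A := fun q : Fin (r + 1) × Fin M => Fin n → X q.1)
    (fun q => wordWeight p q.1) (fun q => sum_wordWeight p q.1 n) _ he
    (fun z => F (z none) fun s => z (some s))
  refine h.trans ?_
  rw [← Fintype.sum_prod_type (f := fun ax : (Fin n → X s') × (∀ s, Fin n → X s) =>
    wordWeight p s' ax.1 * ((∏ s, wordWeight p s (ax.2 s)) * F ax.1 ax.2))]
  refine Fintype.sum_equiv (Equiv.piOptionEquivProd (β := fun o : Option (Fin (r + 1)) =>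
    Fin n → X (o.elim (s', m') fun s => (s, μ s)).1)) _ _ fun z => ?_
  rw [Fintype.prod_option, mul_assoc]
  rfl

variable [∀ s, Fintype (Y s)]

theorem jointLaw_nonneg (W : Channel X Y) (p : ∀ s, stdSimplex ℝ (X s))
    (ω : (∀ s, X s) × (∀ s, Y s)) : 0 ≤ jointLaw W p ω :=
  mul_nonneg (Finset.prod_nonneg fun s _ => (p s).2.1 _) (W.law_nonneg _ _)

theorem sum_jointLaw_mul_fst (W : Channel X Y) (p : ∀ s, stdSimplex ℝ (X s))
    (F : (∀ s, X s) → ℝ) :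
    ∑ ω, jointLaw W p ω * F ω.1 = ∑ x : ∀ s, X s, (∏ s, (p s).1 (x s)) * F x := by
  rw [Fintype.sum_prod_type]
  refine Finset.sum_congr rfl fun x _ => ?_
  simp only [jointLaw, mul_right_comm _ (W.law _ _), ← Finset.mul_sum, W.sum_law, mul_one]

theorem sum_jointLaw (W : Channel X Y) (p : ∀ s, stdSimplex ℝ (X s)) :
    ∑ ω, jointLaw W p ω = 1 := by
  have h := sum_jointLaw_mul_fst W p fun _ => 1
  simp only [mul_one] at h
  rw [h, show (1 : ℝ) = ∏ s, ∑ a, (p s).1 a from (Finset.prod_eq_one fun s _ => (p s).2.2).symm]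
  exact (Fintype.prod_sum _).symm

theorem sum_jointLaw_mul_comp {κ : Type*} [Fintype κ] [DecidableEq κ] (W : Channel X Y)
    (p : ∀ s, stdSimplex ℝ (X s)) (e : κ → Fin (r + 1)) (he : Function.Injective e)
    (F : (∀ k, X (e k)) → ℝ) :
    ∑ ω, jointLaw W p ω * F (fun k => ω.1 (e k)) =
      ∑ z : ∀ k, X (e k), (∏ k, (p (e k)).1 (z k)) * F z := by
  rw [sum_jointLaw_mul_fst W p fun x => F fun k => x (e k)]
  exact sum_prod_comp_injective (fun s => (p s).1) (fun s => (p s).2.2) e he F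

theorem distribution_jointLaw_input (W : Channel X Y) (p : ∀ s, stdSimplex ℝ (X s))
    (s : Fin (r + 1)) (a : X s) : distribution (jointLaw W p) (fun ω => ω.1 s) a = (p s).1 a := by
  classical
  have h := sum_jointLaw_mul_comp W p (fun _ : Unit => s) (Function.injective_of_subsingleton _)
    fun z => if z () = a then 1 else 0
  simp only [mul_ite, mul_one, mul_zero] at h
  simp only [distribution]
  rw [h, ← Fintype.sum_equiv (Equiv.funUnique Unit (X s)).symm
    (fun b => if b = a then (p s).1 b else 0) _ (by simp)]
  simp

theorem distribution_jointLaw_input_pair (W : Channel X Y) (p : ∀ s, stdSimplex ℝ (X s))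
    {s t : Fin (r + 1)} (hst : s ≠ t) (a : X s) (c : X t) :
    distribution (jointLaw W p) (fun ω => (ω.1 s, ω.1 t)) (a, c) =
      distribution (jointLaw W p) (fun ω => ω.1 s) a *
        distribution (jointLaw W p) (fun ω => ω.1 t) c := by
  classical
  rw [distribution_jointLaw_input, distribution_jointLaw_input]
  have he : Function.Injective (fun o : Option Unit => o.elim s fun _ => t) := by
    rintro (_ | _) (_ | _) h
    · rfl
    · exact absurd h hst
    · exact absurd h.symm hst
    · rfl
  have h := sum_jointLaw_mul_comp W p _ he fun z =>
    (if z none = a then 1 else 0) * (if z (some ()) = c then 1 else 0)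
  have h₁ : distribution (jointLaw W p) (fun ω => (ω.1 s, ω.1 t)) (a, c) =
      ∑ ω, jointLaw W p ω * ((if ω.1 s = a then 1 else 0) * (if ω.1 t = c then 1 else 0)) := by
    refine Finset.sum_congr rfl fun ω _ => ?_
    simp only [Prod.mk.injEq]
    split_ifs <;> simp_all
  refine (h₁.trans h).trans ?_
  rw [Fintype.sum_equiv (Equiv.piOptionEquivProd (β := fun o : Option Unit =>
    X (o.elim s fun _ => t))) _ (fun z => ((p s).1 z.1 * (if z.1 = a then 1 else 0)) *
      ((p t).1 (z.2 ()) * (if z.2 () = c then 1 else 0))) fun z => by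
      rw [Fintype.prod_option, Fintype.prod_unique, mul_mul_mul_comm]
      rfl, Fintype.sum_prod_type]
  refine (Fintype.sum_mul_sum (fun b : X s => (p s).1 b * (if b = a then 1 else 0))
    fun z : Unit → X t => (p t).1 (z ()) * (if z () = c then 1 else 0)).symm.trans ?_
  refine congrArg₂ (· * ·) (by simp) ?_
  refine (Fintype.sum_equiv (Equiv.funUnique Unit (X t)) _
    (fun d => (p t).1 d * (if d = c then 1 else 0)) fun _ => rfl).trans ?_
  simp

theorem distribution_pair_const {Ω α : Type*} [Fintype Ω] {μ : Ω → ℝ} (hμ : ∑ ω, μ ω = 1)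
    (A : Ω → α) (a : α) (c : Unit) : distribution μ (fun ω => (A ω, ())) (a, c) =
      distribution μ A a * distribution μ (fun _ => ()) c := by
  have hc : distribution μ (fun _ => ()) c = 1 := by simp [distribution, hμ]
  rw [hc, mul_one]
  refine Finset.sum_congr rfl fun ω _ => ?_
  by_cases h : A ω = a
  · rw [if_pos h, if_pos (show (A ω, ()) = (a, c) from Prod.ext h rfl)]
  · rw [if_neg h, if_neg fun h' : (A ω, ()) = (a, c) => h (congrArg Prod.fst h')]

/-- Pairs of an array of input words and a word of outputs are words of pairs. -/
def wordsEquiv (X : Fin (r + 1) → Type u) (Y : Fin (r + 1) → Type v) (n : ℕ) :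
    ((∀ s, Fin n → X s) × (Fin n → ∀ s, Y s)) ≃ (Fin n → (∀ s, X s) × (∀ s, Y s)) where
  toFun xy i := (fun s => xy.1 s i, xy.2 i)
  invFun ω := (fun s i => (ω i).1 s, fun i => (ω i).2)
  left_inv _ := rfl
  right_inv _ := rfl

/-- Random codewords sent through the memoryless channel make the input-output pairs independent
with law `jointLaw W p`. -/
theorem sum_wordWeight_mul_sum (W : Channel X Y) (p : ∀ s, stdSimplex ℝ (X s)) {n : ℕ}
    (P : (Fin n → (∀ s, X s) × (∀ s, Y s)) → Prop) [DecidablePred P] :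
    ∑ x : ∀ s, Fin n → X s, (∏ s, wordWeight p s (x s)) *
        ∑ y : Fin n → ∀ s, Y s, (if P (fun i => (fun s => x s i, y i)) then
          ∏ i, W.law (fun s => x s i) (y i) else 0) =
      ∑ ω : Fin n → (∀ s, X s) × (∀ s, Y s), if P ω then ∏ i, jointLaw W p (ω i) else 0 := by
  simp only [Finset.mul_sum]
  rw [← Fintype.sum_prod_type (f := fun xy : (∀ s, Fin n → X s) × (Fin n → ∀ s, Y s) =>
    (∏ s, wordWeight p s (xy.1 s)) * (if P (fun i => (fun s => xy.1 s i, xy.2 i)) then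
          ∏ i, W.law (fun s => xy.1 s i) (xy.2 i) else 0))]
  refine Fintype.sum_equiv (wordsEquiv X Y n) _ _ fun xy => ?_
  simp only [wordsEquiv, Equiv.coe_fn_mk, mul_ite, mul_zero, jointLaw, wordWeight,
    Finset.prod_mul_distrib]
  rw [Finset.prod_comm]

open Classical in
/-- Decode to a message whose codeword is sufficiently dense given the observations, if any. -/
def thresholdDecode {α β γ : Type*} (d : α → β → γ → ℝ) (θ : ℝ) {M n : ℕ} (m₀ : Fin M)
    (x : Fin M → Fin n → α) (y : Fin n → β) (z : Fin n → γ) : Fin M :=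
  if h : ∃ m, θ ≤ ∏ i, d (x m i) (y i) (z i) then h.choose else m₀

open Classical in
-- An error requires that the true message miss the threshold or that some other message reach it;
-- then the union bound applies.
theorem ite_thresholdDecode_ne_le {α β γ : Type*} (d : α → β → γ → ℝ) (θ : ℝ) {M n : ℕ}
    (m₀ : Fin M) (x : Fin M → Fin n → α) (y : Fin n → β) (z : Fin n → γ) (m : Fin M) {P : ℝ}
    (hP : 0 ≤ P) :
    (if thresholdDecode d θ m₀ x y z ≠ m then P else 0) ≤
      (if ∏ i, d (x m i) (y i) (z i) < θ then P else 0) +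
      ∑ m' ∈ Finset.univ.erase m, if θ ≤ ∏ i, d (x m' i) (y i) (z i) then P else 0 := by
  have hsum : 0 ≤ ∑ m' ∈ Finset.univ.erase m,
      if θ ≤ ∏ i, d (x m' i) (y i) (z i) then P else 0 :=
    Finset.sum_nonneg fun m' _ => by split_ifs <;> simp [hP]
  by_cases hm : ∏ i, d (x m i) (y i) (z i) < θ
  · rw [if_pos hm]
    split_ifs <;> linarith
  · rw [if_neg hm, zero_add]
    split_ifs with hne
    · have h : ∃ m, θ ≤ ∏ i, d (x m i) (y i) (z i) := ⟨m, not_lt.mp hm⟩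
      rw [thresholdDecode, dif_pos h] at hne
      have h₁ := Finset.single_le_sum
        (f := fun m' => if θ ≤ ∏ i, d (x m' i) (y i) (z i) then P else 0)
        (fun m' _ => by split_ifs <;> simp [hP])
        (Finset.mem_erase.mpr ⟨hne, Finset.mem_univ h.choose⟩)
      simpa [h.choose_spec] using h₁
    · exact hsum

open Classical in
/-- The average over the random codebooks of the probability that a block is wrongly decoded, by
a receiver that observes `y s` and the function `g` of the inputs and that decodes the message
of the transmitter `s'`. -/
theorem sum_codebookWeight_mul_error_le (W : Channel X Y) (p : ∀ s, stdSimplex ℝ (X s))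
    (s' s : Fin (r + 1)) {γ : Type*} [Fintype γ] (g : (∀ s, X s) → γ)
    (hg : ∀ a c, distribution (jointLaw W p) (fun ω => (ω.1 s', g ω.1)) (a, c) =
      distribution (jointLaw W p) (fun ω => ω.1 s') a *
        distribution (jointLaw W p) (fun ω => g ω.1) c)
    {θ : ℝ} (hθ : 0 < θ) {M n : ℕ} (m₀ : Fin M) (μ : Fin (r + 1) → Fin M) :
    let d := density (jointLaw W p) (fun ω => ω.1 s') (fun ω => ω.2 s) (fun ω => g ω.1)
    ∑ C : Codebook X M n, codebookWeight p C * ∑ y : Fin n → ∀ s, Y s,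
        (if thresholdDecode d θ m₀ (fun m => C (s', m)) (fun i => y i s)
            (fun i => g fun t => C (t, μ t) i) ≠ μ s' then
          ∏ i, W.law (fun t => C (t, μ t) i) (y i) else 0) ≤
      ∑ ω : Fin n → (∀ s, X s) × (∀ s, Y s),
        (if ∏ i, d ((ω i).1 s') ((ω i).2 s) (g (ω i).1) < θ then
          ∏ i, jointLaw W p (ω i) else 0) + (M - 1) * θ⁻¹ := by
  intro d
  have h₁ : ∀ C : Codebook X M n, ∀ y : Fin n → ∀ s, Y s, _ := fun C y =>
    ite_thresholdDecode_ne_le d θ m₀ (fun m => C (s', m)) (fun i => y i s)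
      (fun i => g fun t => C (t, μ t) i) (μ s')
      (Finset.prod_nonneg fun i (_ : i ∈ Finset.univ) =>
        W.law_nonneg (fun t => C (t, μ t) i) (y i))
  refine (Finset.sum_le_sum fun C _ => mul_le_mul_of_nonneg_left
    (Finset.sum_le_sum fun y _ => h₁ C y) (codebookWeight_nonneg p C)).trans ?_
  simp only [Finset.sum_add_distrib, mul_add]
  refine add_le_add (le_of_eq ?_) ?_
  · rw [sum_codebookWeight_mul p μ fun x => ∑ y : Fin n → ∀ s, Y s,
      if ∏ i, d (x s' i) (y i s) (g fun t => x t i) < θ then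
        ∏ i, W.law (fun t => x t i) (y i) else 0]
    exact sum_wordWeight_mul_sum W p fun ω => ∏ i, d ((ω i).1 s') ((ω i).2 s) (g (ω i).1) < θ
  -- Each of the `M - 1` wrong messages has a codeword independent of the observations, so it costs
  -- at most `θ⁻¹`.
  · have h₂ : ∀ m' ∈ Finset.univ.erase (μ s'),
        ∑ C : Codebook X M n, codebookWeight p C * ∑ y : Fin n → ∀ s, Y s,
          (if θ ≤ ∏ i, d (C (s', m') i) (y i s) (g fun t => C (t, μ t) i) then
            ∏ i, W.law (fun t => C (t, μ t) i) (y i) else 0) ≤ θ⁻¹ := by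
      intro m' hm'
      rw [sum_codebookWeight_mul_of_ne p μ (Finset.ne_of_mem_erase hm')
        fun a x => ∑ y : Fin n → ∀ s, Y s,
          if θ ≤ ∏ i, d (a i) (y i s) (g fun t => x t i) then
            ∏ i, W.law (fun t => x t i) (y i) else 0]
      refine le_trans (le_of_eq ?_) (sum_prod_ite_le_prod_density_le (jointLaw_nonneg W p)
        (sum_jointLaw W p) (fun ω => ω.2 s) hg hθ n)
      refine Finset.sum_congr rfl fun a _ => ?_
      rw [← Finset.mul_sum, ← Finset.mul_sum, sum_wordWeight_mul_sum W p fun ω =>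
        θ ≤ ∏ i, d (a i) ((ω i).2 s) (g (ω i).1)]
      simp only [distribution_jointLaw_input]
      rfl
    simp only [Finset.sum_comm (s := (Finset.univ : Finset (Fin n → ∀ s, Y s))), Finset.mul_sum]
    rw [Finset.sum_comm]
    simp only [← Finset.mul_sum]
    refine (Finset.sum_le_sum h₂).trans (le_of_eq ?_)
    rw [Finset.sum_const, Finset.card_erase_of_mem (Finset.mem_univ _), Finset.card_univ,
      Fintype.card_fin, nsmul_eq_mul, Nat.cast_sub (Nat.one_le_of_lt m₀.isLt), Nat.cast_one]

open Classical in
/-- Below the conditional mutual information there are decoders with small average error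
probability over the random codebooks, when the blocks are long. -/
theorem eventually_exists_decoder (W : Channel X Y) (p : ∀ s, stdSimplex ℝ (X s))
    (s' s : Fin (r + 1)) {γ : Type*} [Fintype γ] (g : (∀ s, X s) → γ)
    (hg : ∀ a c, distribution (jointLaw W p) (fun ω => (ω.1 s', g ω.1)) (a, c) =
      distribution (jointLaw W p) (fun ω => ω.1 s') a *
        distribution (jointLaw W p) (fun ω => g ω.1) c)
    {ρ : ℝ} (hρ : ρ < condMutualInfo (jointLaw W p) (fun ω => ω.1 s') (fun ω => ω.2 s)
      (fun ω => g ω.1)) {ε : ℝ} (hε : 0 < ε) :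
    ∀ᶠ n : ℕ in Filter.atTop, ∀ M : ℕ, 0 < M → (M : ℝ) - 1 ≤ 2 ^ (n * ρ) →
      ∃ dec : Codebook X M n → (Fin n → Y s) → (Fin n → γ) → Fin M, ∀ μ : Fin (r + 1) → Fin M,
        ∑ C : Codebook X M n, codebookWeight p C * ∑ y : Fin n → ∀ s, Y s,
          (if dec C (fun i => y i s) (fun i => g fun t => C (t, μ t) i) ≠ μ s' then
            ∏ i, W.law (fun t => C (t, μ t) i) (y i) else 0) ≤ ε := by
  set I := condMutualInfo (jointLaw W p) (fun ω => ω.1 s') (fun ω => ω.2 s) (fun ω => g ω.1)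
    with hI
  -- The threshold exponent is put midway between `ρ` and `I`: the true codeword has slack for
  -- Chebyshev's inequality, and the wrong ones contribute at most 2 ^ (-n (I - ρ) / 2) in total.
  have hη : 0 < (I - ρ) / 2 := by linarith
  obtain ⟨K, hK⟩ := sum_prod_ite_prod_density_lt_le (jointLaw_nonneg W p) (sum_jointLaw W p)
    (fun ω => ω.1 s') (fun ω => ω.2 s) (fun ω => g ω.1) hη
  have hlim : Filter.Tendsto (fun n : ℕ => K / n + ((2 : ℝ) ^ (-((I - ρ) / 2))) ^ n)
      Filter.atTop (nhds (0 + 0)) := by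
    refine (tendsto_const_div_atTop_nhds_zero_nat K).add
      (tendsto_pow_atTop_nhds_zero_of_lt_one (by positivity) ?_)
    exact Real.rpow_lt_one_of_one_lt_of_neg (by norm_num) (by linarith)
  rw [add_zero] at hlim
  filter_upwards [hlim.eventually (gt_mem_nhds hε), Filter.eventually_gt_atTop 0]
    with n hn hn₀ M hM hMρ
  refine ⟨fun C y z => thresholdDecode
    (density (jointLaw W p) (fun ω => ω.1 s') (fun ω => ω.2 s) (fun ω => g ω.1))
    ((2 : ℝ) ^ (n * (I - (I - ρ) / 2))) ⟨0, hM⟩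
    (fun m => C (s', m)) y z, fun μ => ?_⟩
  refine (sum_codebookWeight_mul_error_le W p s' s g hg (by positivity) ⟨0, hM⟩ μ).trans ?_
  refine (add_le_add (hK n hn₀) (mul_le_mul_of_nonneg_right hMρ (by positivity))).trans
    (le_trans (le_of_eq ?_) hn.le)
  congr 1
  rw [← Real.rpow_neg (by norm_num), ← Real.rpow_add (by norm_num), ← Real.rpow_natCast,
    ← Real.rpow_mul (by norm_num)]
  congr 1
  ring

end RandomCoding

/-! ### Reduction to the decoding of single blocks -/

section Prefix

variable {r : ℕ} {X : Fin (r + 1) → Type u} {Y : Fin (r + 1) → Type v} {𝓦 : Type w} {n : ℕ}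

theorem Code.sum_outputProb [∀ s, Fintype (Y s)] (C : Code X Y 𝓦 n) (W : Channel X Y) (m : 𝓦) :
    ∑ y, C.outputProb W m y = 1 :=
  sum_prod_causal n (fun i (h : Fin i → ∀ s, Y s) a => W.law (Fin.cons (C.encSource m i)
    fun k => C.encRelay k i fun j => h j k.castSucc) a) fun _ _ => W.sum_law _

theorem Code.outputProb_nonneg [∀ s, Fintype (Y s)] (C : Code X Y 𝓦 n) (W : Channel X Y) (m : 𝓦)
    (y : Fin n → ∀ s, Y s) : 0 ≤ C.outputProb W m y :=
  Finset.prod_nonneg fun _ _ => W.law_nonneg _ _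

end Prefix

namespace OneHopScheme

variable {r : ℕ} {X : Fin (r + 1) → Type u} {Y : Fin (r + 1) → Type v} {M B n : ℕ}

/-- The message that a node in position `q` has in its memory in block `c` if no error occurs. -/
def message (S : OneHopScheme X Y M B n) (m : Fin B → Fin M) (q c : ℕ) : Fin M :=
  if h : q ≤ c ∧ c < q + B then m ⟨c - q, by omega⟩ else S.dummy

theorem message_add (S : OneHopScheme X Y M B n) (m : Fin B → Fin M) (q : ℕ) (j : Fin B) :
    S.message m q (j + q) = m j := by
  have hj := j.isLt
  rw [message, dif_pos (by omega)]
  congr 1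
  ext
  simp

/-- Data move one position per block. -/
theorem message_succ_succ (S : OneHopScheme X Y M B n) (m : Fin B → Fin M) (q c : ℕ) :
    S.message m (q + 1) (c + 1) = S.message m q c := by
  simp only [message]
  by_cases h : q ≤ c ∧ c < q + B
  · rw [dif_pos h, dif_pos (by omega)]
    congr 1
    ext
    simp
  · rw [dif_neg h, dif_neg (by omega)]

/-- The position of a receiver in the flow of data. -/
def receiverPosition (S : OneHopScheme X Y M B n) : Fin (r + 1) → ℕ :=
  Fin.snoc (α := fun _ => ℕ) S.position (r + 1)

theorem receiverPosition_castSucc (S : OneHopScheme X Y M B n) (k : Fin r) :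
    S.receiverPosition k.castSucc = S.position k :=
  Fin.snoc_castSucc (α := fun _ => ℕ) _ _ _

theorem receiverPosition_last (S : OneHopScheme X Y M B n) :
    S.receiverPosition (Fin.last r) = r + 1 :=
  Fin.snoc_last (α := fun _ => ℕ) _ _

theorem receiverPosition_pos (S : OneHopScheme X Y M B n) (s : Fin (r + 1)) :
    0 < S.receiverPosition s := by
  refine Fin.lastCases ?_ (fun k => ?_) s
  · rw [receiverPosition_last]
    omega
  · rw [receiverPosition_castSucc, position]
    omega

/-- The messages that the transmitters encode in block `c` if no error occurs. -/
def sentMessage (S : OneHopScheme X Y M B n) (m : Fin B → Fin M) (c : ℕ) :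
    Fin (r + 1) → Fin M :=
  Fin.cons (S.message m 0 c) fun k => S.message m (S.position k) c

/-- The channel input at time `i` if no error occurs. -/
def idealInput (S : OneHopScheme X Y M B n) (m : Fin B → Fin M) (i : Fin ((B + r) * n))
    (s : Fin (r + 1)) : X s :=
  S.codeword s (S.sentMessage m (i / n) s) (offset i)

/-- The `l`-th channel use of block `c`. -/
def blockTime {N n : ℕ} (c : Fin N) (l : Fin n) : Fin (N * n) :=
  ⟨c * n + l, by
    have h := Nat.mul_le_mul_right n (Nat.succ_le_of_lt c.isLt)
    have := l.isLt
    rw [Nat.succ_mul] at h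
    omega⟩

theorem blockTime_injective {N n : ℕ} (c : Fin N) :
    Function.Injective (blockTime c : Fin n → Fin (N * n)) := fun l l' h => by
  have := congrArg Fin.val h
  simp only [blockTime] at this
  ext
  omega

theorem blockTime_div {N n : ℕ} (c : Fin N) (l : Fin n) : (blockTime c l : ℕ) / n = c := by
  have hl := l.isLt
  change ((c : ℕ) * n + l) / n = c
  rw [mul_comm, Nat.mul_add_div (by omega), Nat.div_eq_of_lt hl, add_zero]

theorem offset_blockTime {N n : ℕ} (c : Fin N) (l : Fin n) : offset (blockTime c l) = l := by
  ext
  simp [offset, blockTime, Nat.mod_eq_of_lt l.isLt]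

/-- Receiver `s`, with the right message in its memory, is wrong at the end of block `c`. -/
def BlockError (S : OneHopScheme X Y M B n) (m : Fin B → Fin M) (c : ℕ) (s : Fin (r + 1))
    (y : Fin n → ∀ s, Y s) : Prop :=
  S.decodeBlock s (fun l => y l s) (S.message m (S.receiverPosition s) c) ≠
    S.message m (S.receiverPosition s) (c + 1)

/-- Some receiver, with the right message in its memory, is wrong at the end of some block. -/
def SomeBlockError (S : OneHopScheme X Y M B n) (m : Fin B → Fin M)
    (y : Fin ((B + r) * n) → ∀ s, Y s) : Prop :=
  ∃ (c : Fin (B + r)) (s : Fin (r + 1)), S.BlockError m c s fun l => y (blockTime c l)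

/-- Reconciles the relay encoder, which is given only a prefix of the received word, with estimates
computed from the whole word. -/
theorem memory_castLE (S : OneHopScheme X Y M B n) (s : Fin (r + 1)) (q : ℕ) {i j : ℕ}
    (hij : i ≤ j) (y : Fin j → Y s) : ∀ (c : ℕ) (hc : c * n ≤ i),
    S.memory s q (fun l => y (Fin.castLE hij l)) c hc = S.memory s q y c (hc.trans hij)
  | 0, _ => rfl
  | c + 1, hc => by
    simp only [memory]
    rw [S.memory_castLE s q hij y c]
    rfl

/-- Induction on blocks: a correct memory and no block error give a correct next memory. The
argument is deterministic and uses nothing about how `y` arose. -/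
theorem memory_eq_message (S : OneHopScheme X Y M B n) {m : Fin B → Fin M}
    {y : Fin ((B + r) * n) → ∀ s, Y s} (hy : ¬ S.SomeBlockError m y) (s : Fin (r + 1)) :
    ∀ (c : ℕ) (_ : c ≤ B + r) (hc : c * n ≤ (B + r) * n),
      S.memory s (S.receiverPosition s) (fun i => y i s) c hc =
        S.message m (S.receiverPosition s) c
  | 0, _, _ => by
    -- A receiver has position at least one, so in block `0` its correct memory is the dummy.
    have := S.receiverPosition_pos s
    rw [memory, message, dif_neg (by omega)]
  | c + 1, h, hc => by
    rw [memory, S.memory_eq_message hy s c (by omega)]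
    split_ifs with hq
    · by_contra hne
      exact hy ⟨⟨c, h⟩, s, hne⟩
    · rw [message, dif_neg hq]

theorem toCode_input_eq (S : OneHopScheme X Y M B n) {m : Fin B → Fin M}
    {y : Fin ((B + r) * n) → ∀ s, Y s} (hy : ¬ S.SomeBlockError m y) (i : Fin ((B + r) * n)) :
    S.toCode.input m y i = S.idealInput m i := by
  funext s
  refine Fin.cases ?_ (fun k => ?_) s
  · simp [Code.input, toCode, idealInput, sentMessage, sourceMessage, message]
  · simp only [Code.input, toCode, idealInput, sentMessage, Fin.cons_succ]
    have hi : (i : ℕ) / n ≤ B + r := (Nat.div_lt_of_lt_mul (i.isLt.trans_eq (mul_comm _ _))).le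
    have h₁ := S.memory_castLE k.castSucc (S.position k) i.isLt.le (fun j => y j k.castSucc)
      (i / n) (Nat.div_mul_le_self i n)
    have h₂ := S.memory_eq_message hy k.castSucc (i / n) hi
      ((Nat.div_mul_le_self i n).trans i.isLt.le)
    rw [receiverPosition_castSucc] at h₂
    rw [h₁, h₂]

theorem relayEstimate_eq (S : OneHopScheme X Y M B n) {m : Fin B → Fin M}
    {y : Fin ((B + r) * n) → ∀ s, Y s} (hy : ¬ S.SomeBlockError m y) (k : Fin r) :
    S.relayEstimate k (fun i => y i k.castSucc) = m := by
  funext j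
  have hk := (S.order.symm k).isLt
  have hj := j.isLt
  have hle : (j : ℕ) + S.position k ≤ B + r := by
    unfold position
    omega
  have h := S.memory_eq_message hy k.castSucc (j + S.position k) hle
    (Nat.mul_le_mul_right n hle)
  rw [receiverPosition_castSucc, message_add] at h
  exact h

theorem destEstimate_eq (S : OneHopScheme X Y M B n) {m : Fin B → Fin M}
    {y : Fin ((B + r) * n) → ∀ s, Y s} (hy : ¬ S.SomeBlockError m y) :
    S.destEstimate (fun i => y i (Fin.last r)) = m := by
  funext j
  have hj := j.isLt
  have hle : (j : ℕ) + (r + 1) ≤ B + r := by omega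
  have h := S.memory_eq_message hy (Fin.last r) (j + (r + 1)) hle (Nat.mul_le_mul_right n hle)
  rw [receiverPosition_last, message_add] at h
  exact h

variable [∀ s, Fintype (Y s)]

open Classical in
/-- The probability, given the messages `m`, that receiver `s` is wrong at the end of block `c`
when all transmitters send what they should. -/
def blockErrorProb (S : OneHopScheme X Y M B n) (W : Channel X Y) (m : Fin B → Fin M) (c : ℕ)
    (s : Fin (r + 1)) : ℝ :=
  ∑ y : Fin n → ∀ s, Y s, if S.BlockError m c s y then
    ∏ l, W.law (fun t => S.codeword t (S.sentMessage m c t) l) (y l) else 0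

open Classical in
-- The actual and the ideal output laws agree off `SomeBlockError` and both sum to one, so they give
-- that event the same probability. Under the ideal law the inputs are fixed by `m`, and the union
-- bound needs only the marginal on one block.
theorem sum_outputProb_someBlockError_le (S : OneHopScheme X Y M B n) (W : Channel X Y)
    (m : Fin B → Fin M) :
    ∑ y, (if S.SomeBlockError m y then S.toCode.outputProb W m y else 0) ≤
      ∑ c : Fin (B + r), ∑ s, S.blockErrorProb W m c s := by
  set Q : (Fin ((B + r) * n) → ∀ s, Y s) → ℝ := fun y => ∏ i, W.law (S.idealInput m i) (y i)
    with hQ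
  have hQ₀ : ∀ y, 0 ≤ Q y := fun y => Finset.prod_nonneg fun i _ => W.law_nonneg _ _
  have hQ₁ : ∑ y, Q y = 1 := by
    rw [hQ, ← Fintype.prod_sum fun i => W.law (S.idealInput m i)]
    exact Finset.prod_eq_one fun i _ => W.sum_law _
  have hgood : ∑ y, (if S.SomeBlockError m y then 0 else S.toCode.outputProb W m y) =
      ∑ y, (if S.SomeBlockError m y then 0 else Q y) := by
    refine Finset.sum_congr rfl fun y _ => ?_
    split_ifs with hy
    · rfl
    · exact Finset.prod_congr rfl fun i _ => by rw [S.toCode_input_eq hy i]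
  have hsplit : ∀ P : (Fin ((B + r) * n) → ∀ s, Y s) → ℝ, ∑ y, P y = 1 →
      ∑ y, (if S.SomeBlockError m y then P y else 0) =
        1 - ∑ y, (if S.SomeBlockError m y then 0 else P y) := by
    intro P hP
    rw [← hP, ← Finset.sum_sub_distrib]
    exact Finset.sum_congr rfl fun y _ => by split_ifs <;> simp
  rw [hsplit _ (S.toCode.sum_outputProb W m), hgood, ← hsplit Q hQ₁]
  have hblock : ∀ (c : Fin (B + r)) (s : Fin (r + 1)), S.blockErrorProb W m c s =
      ∑ y, if S.BlockError m c s (fun l => y (blockTime c l)) then Q y else 0 := by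
    intro c s
    have h := sum_prod_comp_injective (fun i => W.law (S.idealInput m i))
      (fun i => W.sum_law (S.idealInput m i)) (blockTime c) (blockTime_injective c)
      fun z => if S.BlockError m c s z then 1 else 0
    simp only [mul_ite, mul_one, mul_zero] at h
    rw [h]
    refine Finset.sum_congr rfl fun z _ => ?_
    have hinput : ∀ l, S.idealInput m (blockTime c l) =
        fun t => S.codeword t (S.sentMessage m c t) l := by
      intro l
      funext t
      rw [idealInput, blockTime_div, offset_blockTime]
    simp only [hinput]
  simp only [hblock]
  rw [← Fintype.sum_prod_type (f := fun cs : Fin (B + r) × Fin (r + 1) =>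
    ∑ y, if S.BlockError m cs.1 cs.2 (fun l => y (blockTime cs.1 l)) then Q y else 0),
    Finset.sum_comm]
  refine Finset.sum_le_sum fun y _ => ?_
  have hnn : ∀ cs ∈ (Finset.univ : Finset (Fin (B + r) × Fin (r + 1))),
      0 ≤ if S.BlockError m cs.1 cs.2 (fun l => y (blockTime cs.1 l)) then Q y else 0 :=
    fun cs _ => by split_ifs <;> simp [hQ₀]
  split_ifs with hy
  · obtain ⟨c, s, h⟩ := hy
    refine le_trans ?_ (Finset.single_le_sum hnn (Finset.mem_univ (c, s)))
    rw [if_pos h]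
  · exact Finset.sum_nonneg hnn

theorem prob_le (S : OneHopScheme X Y M B n) (W : Channel X Y)
    (E : (Fin B → Fin M) → (Fin ((B + r) * n) → ∀ s, Y s) → Prop)
    (hE : ∀ m y, E m y → S.SomeBlockError m y) :
    S.toCode.prob W E ≤ (Fintype.card (Fin B → Fin M) : ℝ)⁻¹ *
      ∑ m : Fin B → Fin M, ∑ c : Fin (B + r), ∑ s, S.blockErrorProb W m c s := by
  classical
  refine mul_le_mul_of_nonneg_left (Finset.sum_le_sum fun m _ =>
    le_trans (Finset.sum_le_sum fun y _ => ?_) (S.sum_outputProb_someBlockError_le W m))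
    (by positivity)
  have h₀ := S.toCode.outputProb_nonneg W m y
  by_cases h : E m y
  · rw [if_pos h, if_pos (hE m y h)]
  · rw [if_neg h]
    split_ifs <;> simp [h₀]

end OneHopScheme

/-! ### The maximum of the smallest reception rate -/

section Maximum

theorem continuous_entropy {Ω α T : Type*} [Fintype Ω] [Fintype α] [TopologicalSpace T]
    {μ : T → Ω → ℝ} (hμ : ∀ ω, Continuous fun p => μ p ω) (A : Ω → α) :
    Continuous fun p => entropy (μ p) A := by
  classical
  have hd : ∀ a, Continuous fun p => distribution (μ p) A a := fun a =>
    continuous_finsetSum _ fun ω _ => by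
      by_cases h : A ω = a
      · simpa [h] using hμ ω
      · simpa [h] using continuous_const
  -- Continuity at zero probabilities comes from that of `x * log x`.
  have h : ∀ x : ℝ, x * Real.logb 2 x = x * Real.log x / Real.log 2 := fun x => by
    rw [Real.logb, mul_div_assoc]
  simp only [entropy, h]
  exact (continuous_finsetSum _ fun a _ =>
    (Real.continuous_mul_log.comp (hd a)).div_const _).neg

theorem continuous_condMutualInfo {Ω α β γ T : Type*} [Fintype Ω] [Fintype α] [Fintype β]
    [Fintype γ] [TopologicalSpace T] {μ : T → Ω → ℝ} (hμ : ∀ ω, Continuous fun p => μ p ω)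
    (A : Ω → α) (B : Ω → β) (C : Ω → γ) : Continuous fun p => condMutualInfo (μ p) A B C :=
  ((continuous_entropy hμ _).sub (continuous_entropy hμ _)).sub
    ((continuous_entropy hμ _).sub (continuous_entropy hμ _))

variable {r : ℕ} {X : Fin (r + 1) → Type u} {Y : Fin (r + 1) → Type v}
  [∀ s, Fintype (X s)] [∀ s, Fintype (Y s)]

theorem continuous_jointLaw (W : Channel X Y) (ω : (∀ s, X s) × (∀ s, Y s)) :
    Continuous fun p : ∀ s, stdSimplex ℝ (X s) => jointLaw W p ω :=
  (continuous_finsetProd _ fun s _ => (continuous_apply (ω.1 s)).comp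
    (continuous_subtype_val.comp (continuous_apply s))).mul continuous_const

theorem continuous_receptionRate (W : Channel X Y) (π : Equiv.Perm (Fin r)) (s : Fin (r + 1)) :
    Continuous fun p => receptionRate W π p s := by
  refine Fin.lastCases ?_ (fun a => ?_) s
  · simp only [receptionRate, Fin.snoc_last]
    exact continuous_condMutualInfo (continuous_jointLaw W) _ _ _
  · simp only [receptionRate, Fin.snoc_castSucc]
    exact continuous_condMutualInfo (continuous_jointLaw W) _ _ _

theorem continuous_minReceptionRate (W : Channel X Y) (π : Equiv.Perm (Fin r)) :
    Continuous (minReceptionRate W π) :=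
  Continuous.finset_inf'_apply Finset.univ_nonempty fun s _ => continuous_receptionRate W π s

theorem exists_isGreatest_minReceptionRate [∀ s, Nonempty (X s)] (W : Channel X Y) :
    ∃ R₁ : ℝ, IsGreatest {ρ : ℝ | ∃ (π : Equiv.Perm (Fin r)) (p : ∀ s, stdSimplex ℝ (X s)),
      ρ = minReceptionRate W π p} R₁ := by
  classical
  have hset : {ρ : ℝ | ∃ (π : Equiv.Perm (Fin r)) (p : ∀ s, stdSimplex ℝ (X s)),
      ρ = minReceptionRate W π p} = ⋃ π, Set.range (minReceptionRate W π) := by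
    ext ρ
    simp [eq_comm]
  have : ∀ s, CompactSpace (stdSimplex ℝ (X s)) := fun s =>
    isCompact_iff_compactSpace.mp (isCompact_stdSimplex ℝ (X s))
  have : ∀ s, Nonempty (stdSimplex ℝ (X s)) := fun s =>
    ⟨⟨_, single_mem_stdSimplex ℝ (Classical.arbitrary (X s))⟩⟩
  rw [hset]
  refine (isCompact_iUnion fun π =>
    isCompact_range (continuous_minReceptionRate W π)).exists_isGreatest ?_
  exact ⟨_, Set.mem_iUnion.mpr ⟨Equiv.refl _, Classical.arbitrary _, rfl⟩⟩

end Maximum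

/-! ### Achievability -/

section Achievability

variable {r : ℕ} {X : Fin (r + 1) → Type u} {Y : Fin (r + 1) → Type v}

theorem sender_succ (π : Equiv.Perm (Fin r)) (a : Fin r) : sender π a.succ = (π a).succ :=
  Fin.cons_succ (α := fun _ => Fin (r + 1)) _ _ _

theorem sender_injective (π : Equiv.Perm (Fin r)) : Function.Injective (sender π) := by
  refine Fin.cons_injective_iff.mpr ⟨?_, (Fin.succ_injective r).comp π.injective⟩
  rintro ⟨a, ha⟩
  exact Fin.succ_ne_zero _ ha

/-- The transmitter whose message receiver `s` decodes. -/
def predecessor (π : Equiv.Perm (Fin r)) : Fin (r + 1) → Fin (r + 1) :=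
  Fin.snoc (α := fun _ => Fin (r + 1)) (fun k => sender π (π.symm k).castSucc)
    (sender π (Fin.last r))

theorem predecessor_castSucc (π : Equiv.Perm (Fin r)) (a : Fin r) :
    predecessor π (π a).castSucc = sender π a.castSucc :=
  (Fin.snoc_castSucc (α := fun _ => Fin (r + 1)) _ _ _).trans (by rw [π.symm_apply_apply])

theorem predecessor_last (π : Equiv.Perm (Fin r)) :
    predecessor π (Fin.last r) = sender π (Fin.last r) :=
  Fin.snoc_last (α := fun _ => Fin (r + 1)) _ _

namespace OneHopScheme

variable {M B n : ℕ}

theorem position_order (S : OneHopScheme X Y M B n) (a : Fin r) :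
    S.position (S.order a) = a + 1 := by
  rw [position, S.order.symm_apply_apply]

theorem sentMessage_sender (S : OneHopScheme X Y M B n) (m : Fin B → Fin M) (c : ℕ)
    (h : Fin (r + 1)) : S.sentMessage m c (sender S.order h) = S.message m h c := by
  refine Fin.cases rfl (fun a => ?_) h
  rw [sender_succ, sentMessage, Fin.cons_succ, position_order, Fin.val_succ]

/-- The message that a receiver should hold after block `c` is the one its predecessor encodes in
block `c`, so one block suffices to decode it. -/
theorem sentMessage_predecessor (S : OneHopScheme X Y M B n) (m : Fin B → Fin M) (c : ℕ)
    (s : Fin (r + 1)) : S.sentMessage m c (predecessor S.order s) =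
      S.message m (S.receiverPosition s) (c + 1) := by
  refine Fin.lastCases ?_ (fun k => ?_) s
  · rw [predecessor_last, sentMessage_sender, receiverPosition_last, message_succ_succ,
      Fin.val_last]
  · obtain ⟨a, rfl⟩ := S.order.surjective k
    rw [predecessor_castSucc, sentMessage_sender, receiverPosition_castSucc, position_order,
      message_succ_succ, Fin.val_castSucc]

end OneHopScheme

variable [∀ s, Fintype (X s)] [∀ s, Fintype (Y s)]

open Classical in
-- The condition on `m` says that a relay's memory holds the message that it is itself sending; the
-- destination needs no such side information. The decoder is fixed before `μ`, so one rule serves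
-- all blocks and messages.
theorem eventually_exists_decodeBlock (W : Channel X Y) (π : Equiv.Perm (Fin r))
    (p : ∀ s, stdSimplex ℝ (X s)) {ρ : ℝ} (hρ : ρ < minReceptionRate W π p) {ε : ℝ} (hε : 0 < ε)
    (s : Fin (r + 1)) :
    ∀ᶠ n : ℕ in Filter.atTop, ∀ M : ℕ, 0 < M → (M : ℝ) - 1 ≤ 2 ^ (n * ρ) →
      ∃ dec : Codebook X M n → (Fin n → Y s) → Fin M → Fin M,
        ∀ (μ : Fin (r + 1) → Fin M) (m : Fin M), (∀ k : Fin r, s = k.castSucc → μ k.succ = m) →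
        ∑ C : Codebook X M n, codebookWeight p C * ∑ y : Fin n → ∀ s, Y s,
          (if dec C (fun i => y i s) m ≠ μ (predecessor π s) then
            ∏ i, W.law (fun t => C (t, μ t) i) (y i) else 0) ≤ ε := by
  have hrate : ∀ h, ρ < receptionRate W π p h := fun h =>
    hρ.trans_le (Finset.inf'_le _ (Finset.mem_univ h))
  refine Fin.lastCases ?_ (fun k => ?_) s
  · have h := hrate (Fin.last r)
    rw [receptionRate, Fin.snoc_last] at h
    filter_upwards [eventually_exists_decoder W p (sender π (Fin.last r)) (Fin.last r)
      (fun _ => ()) (distribution_pair_const (sum_jointLaw W p) _) h hε] with n hn M hM hMρ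
    obtain ⟨dec, hdec⟩ := hn M hM hMρ
    refine ⟨fun C y _ => dec C y fun _ => (), fun μ m _ => ?_⟩
    rw [predecessor_last]
    exact hdec μ
  · obtain ⟨a, rfl⟩ := π.surjective k
    have h := hrate a.castSucc
    rw [receptionRate, Fin.snoc_castSucc] at h
    have hne : sender π a.castSucc ≠ (π a).succ := by
      rw [← sender_succ]
      exact fun h' => Fin.castSucc_lt_succ.ne (sender_injective π h')
    filter_upwards [eventually_exists_decoder W p (sender π a.castSucc) (π a).castSucc
      (fun x => x (π a).succ) (distribution_jointLaw_input_pair W p hne) h hε] with n hn M hM hMρ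
    obtain ⟨dec, hdec⟩ := hn M hM hMρ
    -- The relay rebuilds its own channel input from its memory and its codebook.
    refine ⟨fun C y m => dec C y (C ((π a).succ, m)), fun μ m hm => ?_⟩
    obtain rfl := hm _ rfl
    rw [predecessor_castSucc]
    exact hdec μ

theorem exists_le_of_sum_mul_le {ι : Type*} [Fintype ι] {w f : ι → ℝ} (hw₀ : ∀ i, 0 ≤ w i)
    (hw : ∑ i, w i = 1) {K : ℝ} (h : ∑ i, w i * f i ≤ K) : ∃ i, f i ≤ K := by
  by_contra! hf
  obtain ⟨i, -, hi⟩ := Finset.exists_ne_zero_of_sum_ne_zero (hw.trans_ne one_ne_zero)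
  have hlt : ∑ i, w i * K < ∑ i, w i * f i :=
    Finset.sum_lt_sum (fun j _ => mul_le_mul_of_nonneg_left (hf j).le (hw₀ j))
      ⟨i, Finset.mem_univ i, mul_lt_mul_of_pos_left (hf i) (lt_of_le_of_ne (hw₀ i) hi.symm)⟩
  rw [← Finset.sum_mul, hw, one_mul] at hlt
  exact absurd h (not_le.mpr hlt)

/-- The scheme in the order `π` that uses the codebook `C` and the decoding rules `dec`. -/
def codebookScheme (π : Equiv.Perm (Fin r)) {M : ℕ} (hM : 0 < M) (B : ℕ) {n : ℕ}
    (C : Codebook X M n) (dec : ∀ s, (Fin n → Y s) → Fin M → Fin M) :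
    OneHopScheme X Y M B n where
  order := π
  dummy := ⟨0, hM⟩
  codeword s m := C (s, m)
  decodeBlock := dec

theorem eventually_exists_scheme (W : Channel X Y) (π : Equiv.Perm (Fin r))
    (p : ∀ s, stdSimplex ℝ (X s)) {ρ : ℝ} (hρ : ρ < minReceptionRate W π p) {ε : ℝ} (hε : 0 < ε)
    {B : ℕ} (hB : 0 < B) :
    ∀ᶠ n : ℕ in Filter.atTop, ∀ M : ℕ, 0 < M → (M : ℝ) - 1 ≤ 2 ^ (n * ρ) →
      ∃ S : OneHopScheme X Y M B n, (Fintype.card (Fin B → Fin M) : ℝ)⁻¹ *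
        ∑ m : Fin B → Fin M, ∑ c : Fin (B + r), ∑ s, S.blockErrorProb W m c s ≤ ε := by
  -- An equal share of the error for each pair of a block and a receiver.
  have hε' : 0 < ε / ((B + r) * (r + 1)) := by positivity
  filter_upwards [Filter.eventually_all.mpr
    (eventually_exists_decodeBlock W π p hρ hε')] with n hn M hM hMρ
  choose dec hdec using fun s => hn s M hM hMρ
  let S : Codebook X M n → OneHopScheme X Y M B n := fun C =>
    codebookScheme π hM B C fun s => dec s C
  -- Any codebook will do here: the intended messages depend only on the order and the dummy, which
  -- all the schemes `S C` share.
  obtain ⟨C₀, -, -⟩ := Finset.exists_ne_zero_of_sum_ne_zero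
    ((sum_codebookWeight p M n).trans_ne one_ne_zero)
  suffices h : ∑ C, codebookWeight p C * ((Fintype.card (Fin B → Fin M) : ℝ)⁻¹ *
      ∑ m : Fin B → Fin M, ∑ c : Fin (B + r), ∑ s, (S C).blockErrorProb W m c s) ≤ ε by
    obtain ⟨C, hC⟩ := exists_le_of_sum_mul_le (codebookWeight_nonneg p)
      (sum_codebookWeight p M n) h
    exact ⟨S C, hC⟩
  have hblock : ∀ (m : Fin B → Fin M) (c : Fin (B + r)) (s : Fin (r + 1)),
      ∑ C, codebookWeight p C * (S C).blockErrorProb W m c s ≤ ε / ((B + r) * (r + 1)) := by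
    intro m c s
    refine le_trans (le_of_eq ?_) (hdec s ((S C₀).sentMessage m c)
      ((S C₀).message m ((S C₀).receiverPosition s) c) ?_)
    · refine Finset.sum_congr rfl fun C _ => ?_
      congr 1
      refine Finset.sum_congr rfl fun y _ => ?_
      have h := (S C₀).sentMessage_predecessor m c s
      rw [show (S C₀).order = π from rfl] at h
      rw [h]
      classical exact if_congr Iff.rfl rfl rfl
    · rintro k rfl
      rw [OneHopScheme.receiverPosition_castSucc]
      rfl
  have hcard : (Fintype.card (Fin B → Fin M) : ℝ) ≠ 0 := by
    simp only [Fintype.card_fun, Fintype.card_fin]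
    positivity
  calc _ = (Fintype.card (Fin B → Fin M) : ℝ)⁻¹ * ∑ m : Fin B → Fin M, ∑ c : Fin (B + r), ∑ s,
        ∑ C, codebookWeight p C * (S C).blockErrorProb W m c s := by
        simp only [mul_left_comm (codebookWeight p _), ← Finset.mul_sum]
        congr 1
        simp only [Finset.mul_sum]
        rw [Finset.sum_comm]
        refine Finset.sum_congr rfl fun m _ => ?_
        rw [Finset.sum_comm]
        refine Finset.sum_congr rfl fun c _ => ?_
        rw [Finset.sum_comm]
    _ ≤ (Fintype.card (Fin B → Fin M) : ℝ)⁻¹ * ∑ m : Fin B → Fin M, ∑ c : Fin (B + r),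
        ∑ s : Fin (r + 1), ε / ((B + r) * (r + 1)) :=
        mul_le_mul_of_nonneg_left (Finset.sum_le_sum fun m _ => Finset.sum_le_sum fun c _ =>
          Finset.sum_le_sum fun s _ => hblock m c s) (by positivity)
    _ = ε := by
        simp only [Finset.sum_const, Finset.card_univ, Fintype.card_fin, nsmul_eq_mul]
        rw [inv_mul_cancel_left₀ hcard]
        push_cast
        field_simp

theorem oneHopAchievable_of_le_minReceptionRate (W : Channel X Y) (π : Equiv.Perm (Fin r))
    (p : ∀ s, stdSimplex ℝ (X s)) {R : ℝ} (hR : R ≤ minReceptionRate W π p) :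
    OneHopAchievable W R := by
  intro ε hε δ hδ
  -- Half of `δ` puts `ρ` strictly below the reception rates; the other half absorbs the factor `B /
  -- (B + r)`. The number of blocks is fixed before their length.
  set ρ := minReceptionRate W π p - δ / 2 with hρ
  have hlim : Filter.Tendsto (fun B : ℕ => (B : ℝ) / (B + r) * ρ) Filter.atTop
      (nhds (1 * ρ)) :=
    (tendsto_natCast_div_add_atTop (r : ℝ)).mul_const ρ
  obtain ⟨B, hBρ, hB⟩ := ((hlim.eventually (lt_mem_nhds (show R - δ < 1 * ρ by linarith))).and
    (Filter.eventually_gt_atTop 0)).exists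
  obtain ⟨n, hn, hn₀⟩ := ((eventually_exists_scheme W π p (ρ := ρ) (by linarith) (half_pos hε)
    hB).and (Filter.eventually_gt_atTop 0)).exists
  -- Rounding up gives `log₂ M ≥ n * ρ` with no rate loss, while `M - 1`, the number of wrong
  -- messages, stays below `2 ^ (n * ρ)`. A negative `ρ` is harmless, since then `M = 1`.
  have hM : 0 < ⌈(2 : ℝ) ^ (n * ρ)⌉₊ := Nat.ceil_pos.mpr (by positivity)
  obtain ⟨S, hS⟩ := hn ⌈(2 : ℝ) ^ (n * ρ)⌉₊ hM
    (by linarith [Nat.ceil_lt_add_one (show 0 ≤ (2 : ℝ) ^ (n * ρ) by positivity)])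
  refine ⟨_, B, n, hB, hn₀, S, ?_, ?_, fun k => ?_⟩
  · have hlog : n * ρ ≤ Real.logb 2 ⌈(2 : ℝ) ^ (n * ρ)⌉₊ := by
      rw [Real.le_logb_iff_rpow_le (by norm_num) (by exact_mod_cast hM)]
      exact Nat.le_ceil _
    have hn' : (0 : ℝ) < n := by exact_mod_cast hn₀
    have hB' : (0 : ℝ) < B := by exact_mod_cast hB
    refine hBρ.le.trans ?_
    rw [Code.rate, Fintype.card_fun, Fintype.card_fin, Fintype.card_fin, Nat.cast_pow,
      Real.logb_pow, le_div_iff₀ (by push_cast; positivity)]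
    calc (B : ℝ) / (B + r) * ρ * ((B + r) * n : ℕ) = B * (n * ρ) := by
          push_cast
          field_simp
      _ ≤ _ := mul_le_mul_of_nonneg_left hlog hB'.le
  · refine (S.prob_le W _ fun m y h => ?_).trans_lt (hS.trans_lt (half_lt_self hε))
    by_contra hy
    exact h (S.destEstimate_eq hy)
  · refine (S.prob_le W _ fun m y h => ?_).trans_lt (hS.trans_lt (half_lt_self hε))
    by_contra hy
    exact h (S.relayEstimate_eq hy k)

end Achievability

end MultipleRelay

end

theorem theorem1 {r : ℕ} {X : Fin (r + 1) → Type*} {Y : Fin (r + 1) → Type*}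
    [∀ s, Fintype (X s)] [∀ s, Nonempty (X s)] [∀ s, Fintype (Y s)]
    (W : MultipleRelay.Channel X Y) :
    ∃ R₁ : ℝ,
      IsGreatest
        {ρ : ℝ | ∃ (π : Equiv.Perm (Fin r)) (p : ∀ s, stdSimplex ℝ (X s)),
          ρ = MultipleRelay.minReceptionRate W π p} R₁ ∧
      ∀ R : ℝ, R ≤ R₁ → MultipleRelay.OneHopAchievable W R := by
  obtain ⟨R₁, hR₁⟩ := MultipleRelay.exists_isGreatest_minReceptionRate W
  obtain ⟨π, p, rfl⟩ := hR₁.1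
  exact ⟨_, hR₁, fun R hR => MultipleRelay.oneHopAchievable_of_le_minReceptionRate W π p hR⟩
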